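/- Let $d\ge 1$ and, for $0<p\le u<\infty$, let $m_{u,p}=m_{u,p}(\mathbb{Z}^d)$ be the classical Morrey sequence space of all $\lambda=\{\lambda_k\}_{k\in\mathbb{Z}^d}\subset\mathbb{C}$ with $$\|\lambda\,|\,m_{u,p}\|=\sup_{j\in\mathbb{N}_0,\;m\in\mathbb{Z}^d}\frac{|Q_{-j,m}|^{1/u}}{|Q_{-j,m}|^{1/p}}\Big(\sum_{k:\,Q_{0,k}\subset Q_{-j,m}}|\lambda_k|^p\Big)^{1/p}<\infty,$$ where $Q_{j,m}=2^{-j}([0,1)^d+m)$ are the dyadic cubes. A bounded linear operator $T:X\to Y$ between quasi-Banach spaces is called strictly singular if $\inf\{\|Tx|Y\|: x\in Z,\ \|x|X\|=1\}=0$ for every infinite-dimensional subspace $Z\subset X$. Let $0<p_i\le u_i<\infty$, $i=1,2$, and $$\frac{u_1}{u_2}\le\min\left(1,\frac{p_1}{p_2}\right).$$ Then $m_{u_1,p_1}\subset m_{u_2,p_2}$, the embedding $\mathrm{id}_u: m_{u_1,p_1}\hookrightarrow m_{u_2,p_2}$ is continuous, and the following holds. (i) If $p_2<u_2$, then $\mathrm{id}_u$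 is strictly singular if, and only if, $p_1=u_1$. (ii) If $p_2=u_2$, then $\mathrm{id}_u$ is strictly singular if, and only if, $u_1=p_1<p_2$. In particular, $\mathrm{id}_u$ is not strictly singular whenever $p_1<u_1$. -/

import Mathlib

open scoped ENNReal

noncomputable section

/-- A quasi-norm on a complex vector space. -/
structure QuasiNorm (E : Type*) [AddCommGroup E] [Module ℂ E] where
  toFun : E → ℝ
  nonneg : ∀ x, 0 ≤ toFun x
  eq_zero_iff : ∀ x, toFun x = 0 ↔ x = 0
  smul : ∀ (c : ℂ) (x : E), toFun (c • x) = ‖c‖ * toFun x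
  exists_add_le : ∃ K : ℝ, ∀ x y, toFun (x + y) ≤ K * (toFun x + toFun y)

namespace QuasiNorm

variable {X Y : Type*} [AddCommGroup X] [Module ℂ X] [AddCommGroup Y] [Module ℂ Y]

/-- `T` is a bounded linear operator from `(X, NX)` to `(Y, NY)`. -/
def IsBoundedOp (NX : QuasiNorm X) (NY : QuasiNorm Y) (T : X →ₗ[ℂ] Y) : Prop :=
  ∃ C : ℝ, ∀ x, NY.toFun (T x) ≤ C * NX.toFun x

/-- `T` is a strictly singular operator from `(X, NX)` to `(Y, NY)`: it is bounded and
`inf {‖T x‖ : x ∈ Z, ‖x‖ = 1} = 0` for every infinite-dimensional linear subspace `Z` of `X`. -/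
def IsStrictlySingular (NX : QuasiNorm X) (NY : QuasiNorm Y) (T : X →ₗ[ℂ] Y) : Prop :=
  IsBoundedOp NX NY T ∧
    ∀ Z : Submodule ℂ X, ¬ FiniteDimensional ℂ Z →
      IsGLB {t : ℝ | ∃ x ∈ Z, NX.toFun x = 1 ∧ t = NY.toFun (T x)} 0

end QuasiNorm

namespace MorreySeq

/-- The dyadic cube `Q_{j,m} = 2^{-j} ([0,1)^d + m)`. -/
def dyadicCube {d : ℕ} (j : ℤ) (m : Fin d → ℤ) : Set (Fin d → ℝ) :=
  Set.univ.pi fun i => Set.Ico ((2 : ℝ) ^ (-j) * m i) ((2 : ℝ) ^ (-j) * (m i + 1))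

/-- The finite set of all lattice points `k` with `Q_{0,k} ⊆ Q_{-j,m}`
(see `mem_cubeIndices_iff`). -/
def cubeIndices {d : ℕ} (j : ℕ) (m : Fin d → ℤ) : Finset (Fin d → ℤ) :=
  Fintype.piFinset fun i => Finset.Ico (2 ^ j * m i) (2 ^ j * (m i + 1))

theorem mem_cubeIndices_iff {d : ℕ} (j : ℕ) (m k : Fin d → ℤ) :
    k ∈ cubeIndices j m ↔ dyadicCube 0 k ⊆ dyadicCube (-(j : ℤ)) m := by
  simp only [cubeIndices, dyadicCube, Fintype.mem_piFinset, Finset.mem_Ico, neg_neg, neg_zero,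
    zpow_zero, one_mul, zpow_natCast]
  constructor
  · intro h x hx i hi
    have h1 := hx i hi
    obtain ⟨h2, h3⟩ := h i
    have h2' : (2 : ℝ) ^ j * m i ≤ k i := by exact_mod_cast h2
    have h3' : (k i : ℝ) + 1 ≤ 2 ^ j * (m i + 1) := by exact_mod_cast h3
    exact ⟨h2'.trans h1.1, h1.2.trans_le h3'⟩
  · intro h i
    have h1 := h (a := fun i => (k i : ℝ)) (fun i _ => ⟨le_refl _, by simp⟩) i (Set.mem_univ i)
    have h2 : (2 : ℝ) ^ j * m i ≤ k i := h1.1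
    have h3 : (k i : ℝ) < 2 ^ j * (m i + 1) := h1.2
    exact ⟨by exact_mod_cast h2, by exact_mod_cast h3⟩

/-- The volume `|Q_{-j,m}| = 2^{jd}` (see `volume_dyadicCube`). -/
def cubeVol (d j : ℕ) : ℝ := 2 ^ (j * d)

theorem volume_dyadicCube {d : ℕ} (j : ℕ) (m : Fin d → ℤ) :
    MeasureTheory.volume (dyadicCube (-(j : ℤ)) m) = ENNReal.ofReal (cubeVol d j) := by
  simp only [dyadicCube, Real.volume_pi_Ico, neg_neg, zpow_natCast]
  have : ∀ i, (2 : ℝ) ^ j * (m i + 1) - 2 ^ j * m i = 2 ^ j := fun i => by ring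
  simp only [this, Finset.prod_const, Finset.card_univ, Fintype.card_fin]
  rw [← ENNReal.ofReal_pow (by positivity), cubeVol, pow_mul]

/-- `|Q_{-j,m}|^{1/u} / |Q_{-j,m}|^{1/p} * (∑_{k : Q_{0,k} ⊆ Q_{-j,m}} |λ_k|^p)^{1/p}`. -/
def localENorm {d : ℕ} (u p : ℝ) (a : (Fin d → ℤ) → ℂ) (j : ℕ) (m : Fin d → ℤ) : ℝ≥0∞ :=
  ENNReal.ofReal (cubeVol d j ^ (1 / u) / cubeVol d j ^ (1 / p)) *
    (∑ k ∈ cubeIndices j m, ‖a k‖ₑ ^ p) ^ (1 / p)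

/-- The Morrey quasi-norm of an arbitrary sequence, with values in `[0, ∞]`. -/
def eNorm {d : ℕ} (u p : ℝ) (a : (Fin d → ℤ) → ℂ) : ℝ≥0∞ :=
  ⨆ (j : ℕ) (m : Fin d → ℤ), localENorm u p a j m

theorem eNorm_zero {d : ℕ} (u : ℝ) {p : ℝ} (hp : 0 < p) :
    eNorm u p (0 : (Fin d → ℤ) → ℂ) = 0 := by
  simp [eNorm, localENorm, hp]

theorem eNorm_smul {d : ℕ} (u : ℝ) {p : ℝ} (hp : 0 < p) (c : ℂ) (a : (Fin d → ℤ) → ℂ) :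
    eNorm u p (c • a) = ‖c‖ₑ * eNorm u p a := by
  simp only [eNorm, ENNReal.mul_iSup]
  refine iSup_congr fun j => iSup_congr fun m => ?_
  simp only [localENorm, Pi.smul_apply, enorm_smul]
  simp_rw [ENNReal.mul_rpow_of_nonneg _ _ hp.le]
  rw [← Finset.mul_sum, ENNReal.mul_rpow_of_nonneg _ _ (by positivity), ← ENNReal.rpow_mul,
    mul_one_div_cancel hp.ne', ENNReal.rpow_one]
  ring

theorem eNorm_add_le {d : ℕ} (u : ℝ) {p : ℝ} (hp : 0 < p) (a b : (Fin d → ℤ) → ℂ) :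
    eNorm u p (a + b) ≤ (2 * 2 ^ (1 / p)) * (eNorm u p a + eNorm u p b) := by
  have key : ∀ (q : ℝ), 0 < q → ∀ x y : ℝ≥0∞, (x + y) ^ q ≤ 2 ^ q * (x ^ q + y ^ q) := by
    intro q hq x y
    have h1 : x + y ≤ 2 * max x y := by
      rw [two_mul]; exact add_le_add (le_max_left _ _) (le_max_right _ _)
    refine (ENNReal.rpow_le_rpow h1 hq.le).trans ?_
    rw [ENNReal.mul_rpow_of_nonneg _ _ hq.le]
    gcongr
    rcases le_total x y with h | h
    · rw [max_eq_right h]; exact le_add_self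
    · rw [max_eq_left h]; exact le_self_add
  have hp' : 0 < 1 / p := by positivity
  refine iSup_le fun j => iSup_le fun m => ?_
  have ha : localENorm u p a j m ≤ eNorm u p a := le_iSup₂_of_le j m le_rfl
  have hb : localENorm u p b j m ≤ eNorm u p b := le_iSup₂_of_le j m le_rfl
  refine le_trans ?_ (mul_le_mul_right (add_le_add ha hb) _)
  unfold localENorm
  have h2 : ∑ k ∈ cubeIndices j m, ‖(a + b) k‖ₑ ^ p ≤
      2 ^ p * (∑ k ∈ cubeIndices j m, ‖a k‖ₑ ^ p + ∑ k ∈ cubeIndices j m, ‖b k‖ₑ ^ p) := by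
    rw [← Finset.sum_add_distrib, Finset.mul_sum]
    refine Finset.sum_le_sum fun k _ => ?_
    exact (ENNReal.rpow_le_rpow (enorm_add_le _ _) hp.le).trans (key p hp _ _)
  have h3 := ENNReal.rpow_le_rpow h2 hp'.le
  rw [ENNReal.mul_rpow_of_nonneg _ _ hp'.le, ← ENNReal.rpow_mul, mul_one_div_cancel hp.ne',
    ENNReal.rpow_one] at h3
  have h4 := h3.trans (mul_le_mul_right (key (1 / p) hp' _ _) 2)
  refine (mul_le_mul_right h4 _).trans (le_of_eq ?_)
  ring

theorem enorm_apply_le_eNorm {d : ℕ} (u : ℝ) {p : ℝ} (hp : 0 < p) (a : (Fin d → ℤ) → ℂ)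
    (k : Fin d → ℤ) : ‖a k‖ₑ ≤ eNorm u p a := by
  refine le_iSup₂_of_le 0 k ?_
  have : cubeIndices 0 k = {k} := by
    ext l
    simp only [cubeIndices, Fintype.mem_piFinset, Finset.mem_Ico, Finset.mem_singleton, pow_zero,
      one_mul]
    refine ⟨fun h => funext fun i => ?_, fun h i => by subst h; simp⟩
    have := h i
    omega
  simp only [localENorm, this, Finset.sum_singleton, cubeVol, zero_mul, pow_zero, Real.one_rpow,
    div_one, ENNReal.ofReal_one, one_mul]
  rw [← ENNReal.rpow_mul, mul_one_div_cancel hp.ne', ENNReal.rpow_one]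

end MorreySeq

open MorreySeq in
/-- The Morrey sequence space `m_{u,p}(ℤ^d)`. -/
def morreySeqSpace (d : ℕ) (u : ℝ) {p : ℝ} (hp : 0 < p) : Submodule ℂ ((Fin d → ℤ) → ℂ) where
  carrier := {a | eNorm u p a < ∞}
  zero_mem' := by
    simp only [Set.mem_ofPred_eq, eNorm_zero u hp, ENNReal.zero_lt_top]
  add_mem' := by
    intro a b ha hb
    refine (eNorm_add_le u hp a b).trans_lt (ENNReal.mul_lt_top ?_ (ENNReal.add_lt_top.2 ⟨ha, hb⟩))
    exact ENNReal.mul_lt_top (by simp)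
      (ENNReal.rpow_lt_top_of_nonneg (by positivity) (by simp))
  smul_mem' := by
    intro c a ha
    simp only [Set.mem_ofPred_eq, eNorm_smul u hp]
    exact ENNReal.mul_lt_top enorm_lt_top ha

open MorreySeq in
/-- The quasi-norm `‖· | m_{u,p}‖` of the Morrey sequence space `m_{u,p}(ℤ^d)`. -/
def morreySeqNorm (d : ℕ) (u : ℝ) {p : ℝ} (hp : 0 < p) : QuasiNorm (morreySeqSpace d u hp) where
  toFun a := (eNorm u p (a : (Fin d → ℤ) → ℂ)).toReal
  nonneg _ := ENNReal.toReal_nonneg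
  eq_zero_iff := by
    rintro ⟨a, ha⟩
    rw [ENNReal.toReal_eq_zero_iff, or_iff_left (ne_of_lt ha)]
    constructor
    · intro h
      ext k
      simpa [h] using enorm_apply_le_eNorm u hp a k
    · intro h
      obtain rfl : a = 0 := congrArg Subtype.val h
      exact eNorm_zero u hp
  smul := by
    intro c a
    rw [Submodule.coe_smul, eNorm_smul u hp, ENNReal.toReal_mul, toReal_enorm]
  exists_add_le := by
    have hK : (2 * 2 ^ (1 / p) : ℝ≥0∞) ≠ ∞ := (ENNReal.mul_lt_top (by simp)
      (ENNReal.rpow_lt_top_of_nonneg (by positivity) (by simp))).ne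
    refine ⟨(2 * 2 ^ (1 / p) : ℝ≥0∞).toReal, ?_⟩
    rintro ⟨a, ha⟩ ⟨b, hb⟩
    rw [← ENNReal.toReal_add (ne_of_lt ha) (ne_of_lt hb), ← ENNReal.toReal_mul]
    exact ENNReal.toReal_mono (ENNReal.mul_ne_top hK (ENNReal.add_ne_top.2 ⟨ne_of_lt ha, ne_of_lt hb⟩))
      (eNorm_add_le u hp a b)

end

/-!
The embedding is contractive: `|a_k|` never exceeds the quasi-norm of `a`, so the exponent `p₁` may
be raised to `q = p₁ u₂ / u₁` inside each cube, and the power mean inequality lowers `q` to `p₂`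
(`MorreySeq.eNorm_le_eNorm`).

If `p₁ < u₁`, the sequences carried by the lacunary set `{(2^i, …, 2^i)}` form an
infinite-dimensional subspace on which both quasi-norms are equivalent to the supremum: a cube of
level `j` contains at most `j + 1` of these points, fewer than a multiple of `|Q|^{1 - p₁/u₁}`. Hence
the embedding is not strictly singular (`MorreySeq.not_isStrictlySingular_of_lt`).

If `p₁ = u₁`, the source is `ℓ_p` with `p = p₁`. In any infinite-dimensional subspace a gliding hump
(`MorreySeq.exists_gliding_hump`) produces an element close to a sum of `n` disjoint, finitely
supported sequences of norm about `1`; its `ℓ_p` quasi-norm has order at least `n^{1/p}`. In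
`m_{u₂,p₂}` with `p₂ < u₂`, humps that are far enough apart have a bounded sum, as a cube meeting two
of them is so large that the factor `|Q|^{1/u₂ - 1/p₂}` makes the earlier ones negligible. In
`ℓ_{p₂} = m_{p₂,p₂}` the sum has norm at most `n^{1/p₂}`, which is of smaller order exactly for
`p < p₂`. Both cases follow from `MorreySeq.isStrictlySingular_of_growth`. If `p₂ = u₂`, the
hypotheses force `p₁ = u₁ ≤ p₂`, and for `p₁ = p₂` the embedding is the identity of `ℓ_{p₁}`.
-/

/-! ### Quasi-norms -/

/-- By homogeneity, a lower bound of `‖T x‖` on the unit sphere of `Z` is a lower bound for the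
operator on all of `Z`. -/
theorem QuasiNorm.mul_le_of_mem_lowerBounds {X Y : Type*} [AddCommGroup X] [Module ℂ X]
    [AddCommGroup Y] [Module ℂ Y] {NX : QuasiNorm X} {NY : QuasiNorm Y} {T : X →ₗ[ℂ] Y}
    {Z : Submodule ℂ X} {b : ℝ}
    (hb : b ∈ lowerBounds {t : ℝ | ∃ x ∈ Z, NX.toFun x = 1 ∧ t = NY.toFun (T x)}) {x : X}
    (hx : x ∈ Z) : b * NX.toFun x ≤ NY.toFun (T x) := by
  rcases (NX.nonneg x).eq_or_lt with h0 | hpos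
  · rw [← h0, mul_zero]
    exact NY.nonneg _
  set r := NX.toFun x with hr
  have hnr : ‖((r⁻¹ : ℝ) : ℂ)‖ = r⁻¹ := by
    rw [Complex.norm_real, Real.norm_of_nonneg (by positivity)]
  have h := hb ⟨((r⁻¹ : ℝ) : ℂ) • x, Z.smul_mem _ hx, by
    rw [NX.smul, hnr, ← hr, inv_mul_cancel₀ hpos.ne'], rfl⟩
  rwa [map_smul, NY.smul, hnr, inv_mul_eq_div, le_div_iff₀ hpos] at h

namespace MorreySeq

/-! ### Dyadic cubes and the embedding -/

variable {d : ℕ}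

theorem mem_cubeIndices {j : ℕ} {m k : Fin d → ℤ} :
    k ∈ cubeIndices j m ↔ ∀ i, k i / 2 ^ j = m i := by
  simp only [cubeIndices, Fintype.mem_piFinset, Finset.mem_Ico]
  refine forall_congr' fun i => ?_
  have h2 : (0 : ℤ) < 2 ^ j := by positivity
  rw [Int.ediv_eq_iff_of_pos h2]
  constructor <;> rintro ⟨h, h'⟩ <;> constructor <;> linarith

theorem card_cubeIndices (j : ℕ) (m : Fin d → ℤ) : (cubeIndices j m).card = 2 ^ (j * d) := by
  simp only [cubeIndices, Fintype.card_piFinset, Int.card_Ico]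
  have : ∀ i, ((2 : ℤ) ^ j * (m i + 1) - 2 ^ j * m i).toNat = 2 ^ j := fun i => by
    have : (2 : ℤ) ^ j * (m i + 1) - 2 ^ j * m i = ((2 ^ j : ℕ) : ℤ) := by push_cast; ring
    rw [this, Int.toNat_natCast]
  simp [this, pow_mul]

/-- The local quantities in a form free of roots: here `2 ^ (j * d)` is the volume of the cube. -/
theorem localENorm_le_iff {u p : ℝ} (hp : 0 < p) (a : (Fin d → ℤ) → ℂ) (N : ℝ≥0∞)
    (j : ℕ) (m : Fin d → ℤ) :
    localENorm u p a j m ≤ N ↔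
      ∑ k ∈ cubeIndices j m, ‖a k‖ₑ ^ p ≤ N ^ p * ((2 : ℝ≥0∞) ^ (j * d)) ^ (1 - p / u) := by
  have hV : (0 : ℝ) < cubeVol d j := by unfold cubeVol; positivity
  have hV2 : ENNReal.ofReal (cubeVol d j) = (2 : ℝ≥0∞) ^ (j * d) := by
    unfold cubeVol
    rw [ENNReal.ofReal_pow (by norm_num)]; norm_num
  have h0 : (2 : ℝ≥0∞) ^ (j * d) ≠ 0 := by positivity
  have ht : (2 : ℝ≥0∞) ^ (j * d) ≠ ∞ := ENNReal.pow_ne_top (by norm_num)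
  unfold localENorm
  rw [← Real.rpow_sub hV, ← ENNReal.ofReal_rpow_of_pos hV, hV2,
    ← ENNReal.rpow_le_rpow_iff hp, ENNReal.mul_rpow_of_nonneg _ _ hp.le, ← ENNReal.rpow_mul,
    ← ENNReal.rpow_mul, one_div_mul_cancel hp.ne', ENNReal.rpow_one]
  have e : (1 / u - 1 / p) * p = -(1 - p / u) := by field_simp; ring
  rw [e, ENNReal.rpow_neg, mul_comm, ← div_eq_mul_inv, ENNReal.div_le_iff]
  · simp
  · exact ENNReal.rpow_ne_top_of_ne_zero h0 ht

theorem eNorm_le_iff {u p : ℝ} (hp : 0 < p) (a : (Fin d → ℤ) → ℂ) (N : ℝ≥0∞) :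
    eNorm u p a ≤ N ↔ ∀ j m,
      ∑ k ∈ cubeIndices j m, ‖a k‖ₑ ^ p ≤ N ^ p * ((2 : ℝ≥0∞) ^ (j * d)) ^ (1 - p / u) := by
  simp only [eNorm, iSup_le_iff, localENorm_le_iff hp]

theorem sum_le_eNorm {u p : ℝ} (hp : 0 < p) (a : (Fin d → ℤ) → ℂ) (j : ℕ) (m : Fin d → ℤ) :
    ∑ k ∈ cubeIndices j m, ‖a k‖ₑ ^ p ≤
      eNorm u p a ^ p * ((2 : ℝ≥0∞) ^ (j * d)) ^ (1 - p / u) :=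
  (eNorm_le_iff hp a _).1 le_rfl j m

/-- The embedding `m_{u₁,p₁} ⊆ m_{u₂,p₂}` has norm at most `1`. With `q = p₁ u₂ / u₁`, which is at
least `p₁` and `p₂`, the bound `|a_k| ≤ ‖a‖` gives the embedding into `m_{u₂,q}`. -/
theorem eNorm_le_eNorm {u₁ p₁ u₂ p₂ : ℝ} (hp₁ : 0 < p₁) (hpu₁ : p₁ ≤ u₁) (hp₂ : 0 < p₂)
    (hpu₂ : p₂ ≤ u₂) (hu : u₁ / u₂ ≤ min 1 (p₁ / p₂)) (a : (Fin d → ℤ) → ℂ) :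
    eNorm u₂ p₂ a ≤ eNorm u₁ p₁ a := by
  have hu₁ : 0 < u₁ := hp₁.trans_le hpu₁
  have hu₂ : 0 < u₂ := hp₂.trans_le hpu₂
  have h1 : u₁ ≤ u₂ := by
    have := hu.trans (min_le_left _ _)
    rwa [div_le_one hu₂] at this
  have h2 : u₁ * p₂ ≤ p₁ * u₂ := by
    have := hu.trans (min_le_right _ _)
    rwa [div_le_div_iff₀ hu₂ hp₂] at this
  set q : ℝ := p₁ * u₂ / u₁ with hq
  have hpq : p₁ ≤ q := by rw [hq, le_div_iff₀ hu₁]; gcongr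
  have hp₂q : p₂ ≤ q := by rw [hq, le_div_iff₀ hu₁]; linarith
  have hq0 : 0 < q := hp₁.trans_le hpq
  set N := eNorm u₁ p₁ a
  rw [eNorm_le_iff hp₂]
  intro j m
  set V : ℝ≥0∞ := (2 : ℝ≥0∞) ^ (j * d) with hV
  have h0 : V ≠ 0 := by positivity
  have ht : V ≠ ∞ := ENNReal.pow_ne_top (by norm_num)
  have hsum : ∑ k ∈ cubeIndices j m, ‖a k‖ₑ ^ q ≤ N ^ q * V ^ (1 - q / u₂) := by
    have e : 1 - q / u₂ = 1 - p₁ / u₁ := by rw [hq]; field_simp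
    have hs : ∀ x : ℝ≥0∞, x ^ q = x ^ (q - p₁) * x ^ p₁ := fun x => by
      rw [← ENNReal.rpow_add_of_nonneg _ _ (by linarith) hp₁.le]; congr 1; ring
    rw [e, hs N, mul_assoc]
    refine le_trans ?_ (mul_le_mul_right (sum_le_eNorm hp₁ a j m) _)
    rw [Finset.mul_sum]
    refine Finset.sum_le_sum fun k _ => ?_
    rw [hs]
    gcongr
    exact enorm_apply_le_eNorm u₁ hp₁ a k
  -- the power mean inequality on the cube lowers the exponent from `q` to `p₂`
  have hmean := ENNReal.rpow_sum_le_const_mul_sum_rpow (cubeIndices j m)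
    (fun k => ‖a k‖ₑ ^ p₂) (p := q / p₂) (by rwa [le_div_iff₀ hp₂, one_mul])
  simp only [← ENNReal.rpow_mul, mul_div_cancel₀ q hp₂.ne', card_cubeIndices] at hmean
  have hr : 0 < q / p₂ := by positivity
  rw [← ENNReal.rpow_le_rpow_iff hr]
  refine hmean.trans ?_
  push_cast
  rw [← hV]
  refine (mul_le_mul_right hsum _).trans (le_of_eq ?_)
  rw [ENNReal.mul_rpow_of_nonneg _ _ hr.le, ← ENNReal.rpow_mul, ← ENNReal.rpow_mul,
    mul_div_cancel₀ q hp₂.ne', mul_left_comm, ← ENNReal.rpow_add _ _ h0 ht]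
  congr 2
  field_simp
  ring

/-! ### Sequences supported on a sparse set -/

/-- The diagonal lattice point `(2^i, …, 2^i)`; the range of `sparsePoint d` is the sparse set. -/
def sparsePoint (d i : ℕ) : Fin d → ℤ := fun _ => 2 ^ i

theorem sparsePoint_injective (hd : 1 ≤ d) : Function.Injective (sparsePoint d) := by
  intro i i' h
  have := congrFun h ⟨0, hd⟩
  simpa [sparsePoint] using this

/-- A dyadic cube of level `j` contains at most `j + 1` points of the sparse set: those with index
`i < j`, and at most one with `j ≤ i`, since then the point is the lower corner of the cube. -/
theorem card_sparse_le (j : ℕ) (m : Fin d → ℤ) (s : Finset (Fin d → ℤ))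
    (hs : ∀ k ∈ s, k ∈ cubeIndices j m ∧ k ∈ Set.range (sparsePoint d)) : s.card ≤ j + 1 := by
  have : s ⊆ insert (fun i => 2 ^ j * m i) ((Finset.range j).image (sparsePoint d)) := by
    intro k hk
    obtain ⟨hkm, i, rfl⟩ := hs k hk
    rw [Finset.mem_insert, Finset.mem_image]
    rcases lt_or_ge i j with h | h
    · exact Or.inr ⟨i, Finset.mem_range.2 h, rfl⟩
    · refine Or.inl (funext fun l => ?_)
      rw [← mem_cubeIndices.1 hkm l]
      exact (Int.mul_ediv_cancel' (pow_dvd_pow 2 h)).symm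
  refine (Finset.card_le_card this).trans ((Finset.card_insert_le _ _).trans ?_)
  gcongr
  exact Finset.card_image_le.trans (Finset.card_range j).le

theorem exists_linear_le_exp {δ : ℝ} (hδ : 0 < δ) :
    ∃ C : ℝ≥0∞, C ≠ ∞ ∧
      ∀ j : ℕ, ((j + 1 : ℕ) : ℝ≥0∞) ≤ C * ((2 : ℝ≥0∞) ^ j) ^ δ := by
  have hr : 1 < (2 : ℝ) ^ δ := Real.one_lt_rpow (by norm_num) hδ
  set η : ℝ := 2 ^ δ - 1
  have hη : 0 < η := by simp only [η]; linarith
  refine ⟨ENNReal.ofReal (1 + 1 / η), ENNReal.ofReal_ne_top, fun j => ?_⟩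
  -- Bernoulli's inequality for the base `2 ^ δ = 1 + η`
  have hB := one_add_mul_le_pow (a := η) (by linarith) j
  have e : ((2 : ℝ≥0∞) ^ j) ^ δ = ENNReal.ofReal ((1 + η) ^ j) := by
    rw [show 1 + η = (2 : ℝ) ^ δ by simp [η], ENNReal.ofReal_pow (by positivity),
      ← ENNReal.ofReal_rpow_of_pos (by norm_num), ← ENNReal.rpow_natCast, ← ENNReal.rpow_natCast,
      ← ENNReal.rpow_mul, ← ENNReal.rpow_mul, mul_comm]
    norm_num
  rw [e, ← ENNReal.ofReal_mul (by positivity), ← ENNReal.ofReal_natCast]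
  refine ENNReal.ofReal_le_ofReal ?_
  push_cast
  calc (j : ℝ) + 1 ≤ (1 + 1 / η) * (1 + j * η) := by
        have : 0 < 1 / η := by positivity
        have h3 : 1 / η * (j * η) = j := by field_simp
        nlinarith [mul_nonneg (Nat.cast_nonneg (α := ℝ) j) hη.le]
    _ ≤ _ := by gcongr

/-- For `p < u`, the `m_{u,p}` quasi-norm of a sequence carried by the sparse set is at most a
constant times its supremum, because `j + 1` is bounded by a multiple of `2^{jd(1-p/u)}`. -/
theorem eNorm_le_of_support_sparse (hd : 1 ≤ d) {u p : ℝ} (hp : 0 < p) (hpu : p < u) :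
    ∃ C : ℝ≥0∞, C ≠ ∞ ∧ ∀ (a : (Fin d → ℤ) → ℂ) (M : ℝ≥0∞),
      (∀ k ∉ Set.range (sparsePoint d), a k = 0) → (∀ k, ‖a k‖ₑ ≤ M) →
        eNorm u p a ≤ C * M := by
  have hδ : 0 < (d : ℝ) * (1 - p / u) := by
    have : p / u < 1 := (div_lt_one (hp.trans hpu)).2 hpu
    have : (0 : ℝ) < d := by exact_mod_cast hd
    apply mul_pos <;> linarith
  obtain ⟨C, hC, hle⟩ := exists_linear_le_exp hδ
  refine ⟨C ^ (1 / p), ENNReal.rpow_ne_top_of_nonneg (by positivity) hC, fun a M ha hM => ?_⟩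
  classical
  rw [eNorm_le_iff hp]
  intro j m
  rw [ENNReal.mul_rpow_of_nonneg _ _ hp.le, ← ENNReal.rpow_mul, one_div_mul_cancel hp.ne',
    ENNReal.rpow_one]
  set s := (cubeIndices j m).filter fun k => k ∈ Set.range (sparsePoint d)
  have hs : s.card ≤ j + 1 := card_sparse_le j m s fun k hk => by simpa [s] using hk
  calc ∑ k ∈ cubeIndices j m, ‖a k‖ₑ ^ p = ∑ k ∈ s, ‖a k‖ₑ ^ p := by
        symm
        refine Finset.sum_subset (Finset.filter_subset _ _) fun k hk hks => ?_
        have : k ∉ Set.range (sparsePoint d) := fun h => hks (Finset.mem_filter.2 ⟨hk, h⟩)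
        simp [ha k this, hp]
    _ ≤ ∑ k ∈ s, M ^ p := Finset.sum_le_sum fun k _ => ENNReal.rpow_le_rpow (hM k) hp.le
    _ = s.card * M ^ p := by rw [Finset.sum_const, nsmul_eq_mul]
    _ ≤ (j + 1 : ℕ) * M ^ p := by gcongr
    _ ≤ (C * ((2 : ℝ≥0∞) ^ j) ^ ((d : ℝ) * (1 - p / u))) * M ^ p := by gcongr; exact hle j
    _ = _ := by
        rw [ENNReal.rpow_mul, ENNReal.rpow_natCast, ← pow_mul]; ring

/-! ### The gliding hump -/

section GlidingHump

variable {ι : Type*}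

/-- The `p`-th power of the `ℓ_p` quasi-norm, with values in `[0, ∞]`. -/
noncomputable def lpMass (p : ℝ) (a : ι → ℂ) : ℝ≥0∞ := ∑' k, ‖a k‖ₑ ^ p

theorem lpMass_smul {p : ℝ} (hp : 0 < p) (c : ℂ) (a : ι → ℂ) :
    lpMass p (c • a) = ‖c‖ₑ ^ p * lpMass p a := by
  simp only [lpMass, Pi.smul_apply, enorm_smul, ENNReal.mul_rpow_of_nonneg _ _ hp.le,
    ENNReal.tsum_mul_left]

theorem lpMass_sub_le {p : ℝ} (hp : 0 < p) (a b : ι → ℂ) :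
    lpMass p (a - b) ≤ 2 ^ p * (lpMass p a + lpMass p b) := by
  simp only [lpMass, ← ENNReal.tsum_add, ← ENNReal.tsum_mul_left]
  refine ENNReal.tsum_le_tsum fun k => ?_
  have h1 : ‖(a - b) k‖ₑ ≤ 2 * max ‖a k‖ₑ ‖b k‖ₑ := by
    rw [two_mul]
    exact enorm_sub_le.trans (add_le_add (le_max_left _ _) (le_max_right _ _))
  refine (ENNReal.rpow_le_rpow h1 hp.le).trans ?_
  rw [ENNReal.mul_rpow_of_nonneg _ _ hp.le]
  gcongr
  rcases le_total ‖a k‖ₑ ‖b k‖ₑ with h | h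
  · rw [max_eq_right h]; exact le_add_self
  · rw [max_eq_left h]; exact le_self_add

theorem lpMass_neg (p : ℝ) (a : ι → ℂ) : lpMass p (-a) = lpMass p a := by simp [lpMass]

theorem lpMass_add_le {p : ℝ} (hp : 0 < p) (a b : ι → ℂ) :
    lpMass p (a + b) ≤ 2 ^ p * (lpMass p a + lpMass p b) := by
  simpa [lpMass_neg] using lpMass_sub_le hp a (-b)

theorem enorm_add_rpow_of_disjoint {p : ℝ} (hp : 0 < p) {z w : ℂ} (h : z = 0 ∨ w = 0) :
    ‖z + w‖ₑ ^ p = ‖z‖ₑ ^ p + ‖w‖ₑ ^ p := by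
  rcases h with rfl | rfl <;> simp [hp]

theorem lpMass_add_of_disjoint {p : ℝ} (hp : 0 < p) {a b : ι → ℂ} (h : ∀ k, a k = 0 ∨ b k = 0) :
    lpMass p (a + b) = lpMass p a + lpMass p b := by
  simp only [lpMass, ← ENNReal.tsum_add, Pi.add_apply, enorm_add_rpow_of_disjoint hp (h _)]

theorem lpMass_eq_zero_iff {p : ℝ} (hp : 0 < p) {a : ι → ℂ} : lpMass p a = 0 ↔ a = 0 := by
  simp [lpMass, ENNReal.tsum_eq_zero, hp, not_lt.2 hp.le, funext_iff]

/-- A sequence of finite mass is, up to `ε`, carried by a finite set. -/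
theorem exists_lpMass_indicator_compl_le {p : ℝ} (hp : 0 < p) {a : ι → ℂ} (ha : lpMass p a ≠ ∞)
    {ε : ℝ≥0∞} (hε : ε ≠ 0) : ∃ G : Finset ι, lpMass p ((G : Set ι)ᶜ.indicator a) ≤ ε := by
  have h := (ENNReal.tendsto_tsum_compl_atTop_zero ha).eventually
    (eventually_le_nhds hε.bot_lt)
  obtain ⟨G, hG⟩ := h.exists
  refine ⟨G, le_trans (le_of_eq ?_) hG⟩
  have := tsum_subtype ((G : Set ι)ᶜ) (fun k => ‖a k‖ₑ ^ p)
  refine Eq.trans (tsum_congr fun k => ?_) this.symm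
  by_cases hk : k ∈ G <;> simp [hk, hp]

theorem exists_ne_zero_vanishing_on_finset {W : Submodule ℂ (ι → ℂ)}
    (hW : ¬ FiniteDimensional ℂ W) (F : Finset ι) : ∃ x ∈ W, x ≠ 0 ∧ ∀ k ∈ F, x k = 0 := by
  by_contra! hcon
  refine hW (Module.Finite.of_injective
    ((LinearMap.funLeft ℂ ℂ (Subtype.val : F → ι)).comp W.subtype) ?_)
  rw [injective_iff_map_eq_zero]
  rintro ⟨x, hx⟩ h0
  by_contra hne
  obtain ⟨k, hk, hxk⟩ := hcon x hx fun h => hne (Subtype.ext h)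
  exact hxk (congrFun h0 ⟨k, hk⟩)

/-- An infinite-dimensional space of sequences of finite mass contains, for each finite set `F`,
a normalised element which vanishes on `F` and is as close as desired to a finitely supported
restriction `y` of itself. -/
theorem exists_hump {p : ℝ} (hp : 0 < p) {W : Submodule ℂ (ι → ℂ)} (hW : ¬ FiniteDimensional ℂ W)
    (hfin : ∀ x ∈ W, lpMass p x ≠ ∞) (F : Finset ι) {ε : ℝ≥0∞} (hε : ε ≠ 0) :
    ∃ x ∈ W, ∃ y : ι → ℂ, y.support.Finite ∧ (∀ k ∈ F, y k = 0) ∧ lpMass p y ≤ 1 ∧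
      1 / 2 ≤ lpMass p y ∧ lpMass p (x - y) ≤ ε := by
  obtain ⟨z, hz, hz0, hzF⟩ := exists_ne_zero_vanishing_on_finset hW F
  have hL0 : lpMass p z ≠ 0 := fun h => hz0 ((lpMass_eq_zero_iff hp).1 h)
  have hL := hfin z hz
  -- `c` normalises `z` to mass `1`
  set c : ℂ := (((lpMass p z).toReal ^ (-(1 / p)) : ℝ) : ℂ)
  have hpos : 0 < (lpMass p z).toReal := ENNReal.toReal_pos hL0 hL
  have hc : ‖c‖ₑ ^ p * lpMass p z = 1 := by
    have e : ‖c‖ₑ = lpMass p z ^ (-(1 / p)) := by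
      rw [← ofReal_norm, Complex.norm_real, Real.norm_of_nonneg (by positivity),
        ← ENNReal.ofReal_rpow_of_pos hpos, ENNReal.ofReal_toReal hL]
    rw [e, ← ENNReal.rpow_mul, neg_mul, one_div_mul_cancel hp.ne', ENNReal.rpow_neg_one,
      ENNReal.inv_mul_cancel hL0 hL]
  have hx1 : lpMass p (c • z) = 1 := by rw [lpMass_smul hp, hc]
  have hxW : c • z ∈ W := W.smul_mem c hz
  obtain ⟨G, hG⟩ := exists_lpMass_indicator_compl_le hp (hfin _ hxW)
    (ε := min ε (1 / 2)) (by simp [hε])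
  set x := c • z
  set y := (G : Set ι).indicator x
  have hxy : x - y = (G : Set ι)ᶜ.indicator x := by
    rw [sub_eq_iff_eq_add, add_comm]
    exact (Set.indicator_self_add_compl _ _).symm
  have hsum : lpMass p y + lpMass p (x - y) = 1 := by
    rw [← lpMass_add_of_disjoint hp, add_sub_cancel, hx1]
    intro k
    rw [hxy]
    by_cases hk : k ∈ G <;> simp [y, hk]
  rw [← hxy] at hG
  refine ⟨x, hxW, y, ?_, ?_, ?_, ?_, hG.trans (min_le_left _ _)⟩
  · exact G.finite_toSet.subset Set.support_indicator_subset
  · intro k hk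
    by_cases hkG : k ∈ G <;> simp [y, hkG, x, hzF k hk]
  · exact hsum ▸ le_self_add
  · have h1 : (1 : ℝ≥0∞) ≤ lpMass p y + 1 / 2 := by
      refine hsum.symm.le.trans ?_
      gcongr
      exact hG.trans (min_le_right _ _)
    have h2 : (1 / 2 : ℝ≥0∞) + 1 / 2 ≤ lpMass p y + 1 / 2 := by rwa [ENNReal.add_halves]
    exact (ENNReal.add_le_add_iff_right (by simp)).1 h2

/-- The gliding hump: `n` almost disjoint normalised elements of `W` are added up. The functional
`A` is an abstract size which grows at most like `g` provided that each new hump avoids a finite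
set depending on the previous ones. -/
theorem exists_gliding_hump {p : ℝ} (hp : 0 < p) {W : Submodule ℂ (ι → ℂ)}
    (hW : ¬ FiniteDimensional ℂ W) (hfin : ∀ x ∈ W, lpMass p x ≠ ∞) {A : (ι → ℂ) → ℝ≥0∞}
    {g : ℕ → ℝ≥0∞} (hA0 : A 0 ≤ g 0)
    (hA : ∀ n, ∀ y : ι → ℂ, y.support.Finite → A y ≤ g n → ∃ F : Finset ι, ∀ y' : ι → ℂ,
      (∀ k ∈ F, y' k = 0) → lpMass p y' ≤ 1 → A (y + y') ≤ g (n + 1))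
    (n : ℕ) {ε : ℝ≥0∞} (hε : ε ≠ 0) :
    ∃ x ∈ W, ∃ y : ι → ℂ, y.support.Finite ∧ (n : ℝ≥0∞) / 2 ≤ lpMass p y ∧ A y ≤ g n ∧
      lpMass p (x - y) ≤ ε := by
  classical
  induction n generalizing ε with
  | zero => exact ⟨0, W.zero_mem, 0, by simp, by simp, hA0, by simp [lpMass, hp]⟩
  | succ n ih =>
    have hK0 : (2 : ℝ≥0∞) ^ p * 2 ≠ 0 :=
      mul_ne_zero (ENNReal.rpow_pos (by norm_num) (by norm_num)).ne' (by norm_num)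
    have hKt : (2 : ℝ≥0∞) ^ p * 2 ≠ ∞ :=
      ENNReal.mul_ne_top (ENNReal.rpow_ne_top_of_nonneg hp.le (by norm_num)) (by norm_num)
    have hε' : ε / (2 ^ p * 2) ≠ 0 := (ENNReal.div_pos hε hKt).ne'
    obtain ⟨x, hx, y, hyfin, hyn, hAy, hxy⟩ := ih hε'
    obtain ⟨F, hF⟩ := hA n y hyfin hAy
    obtain ⟨x', hx', y', hyfin', hyF, hy1, hy2, hxy'⟩ :=
      exists_hump hp hW hfin (F ∪ hyfin.toFinset) hε'
    have hdisj : ∀ k, y k = 0 ∨ y' k = 0 := fun k => by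
      by_cases h : y k = 0
      · exact Or.inl h
      · exact Or.inr (hyF k (by simp [h]))
    refine ⟨x + x', W.add_mem hx hx', y + y', ?_, ?_, ?_, ?_⟩
    · exact (hyfin.union hyfin').subset (Function.support_add _ _)
    · rw [lpMass_add_of_disjoint hp hdisj]
      push_cast
      rw [ENNReal.add_div]
      gcongr
    · exact hF y' (fun k hk => hyF k (Finset.mem_union_left _ hk)) hy1
    · rw [add_sub_add_comm]
      refine (lpMass_add_le hp _ _).trans ((mul_le_mul_right (add_le_add hxy hxy') _).trans ?_)
      rw [← two_mul, ← mul_assoc, ENNReal.mul_div_cancel hK0 hKt]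

end GlidingHump

/-! ### The spaces `m_{p,p}` and `ℓ_p` -/

theorem eNorm_le_lpMass {p : ℝ} (hp : 0 < p) (a : (Fin d → ℤ) → ℂ) :
    eNorm p p a ≤ lpMass p a ^ (1 / p) := by
  rw [eNorm_le_iff hp]
  intro j m
  rw [← ENNReal.rpow_mul, one_div_mul_cancel hp.ne', ENNReal.rpow_one, div_self hp.ne', sub_self,
    ENNReal.rpow_zero, mul_one]
  exact ENNReal.sum_le_tsum _

/-- The `2^d` orthants of the lattice are exhausted by dyadic cubes. A single dyadic cube never
crosses a coordinate hyperplane, so one increasing family of cubes is not enough. -/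
theorem exists_subset_biUnion_cubeIndices (F : Finset (Fin d → ℤ)) :
    ∃ j : ℕ, F ⊆ (Fintype.piFinset fun _ : Fin d => Finset.Ico (-1 : ℤ) 1).biUnion
      (cubeIndices j) := by
  obtain ⟨N, hN⟩ : ∃ N : ℕ, ∀ k ∈ F, ∀ i, (k i).natAbs < N := by
    refine ⟨(F.sup fun k => Finset.univ.sup fun i => (k i).natAbs) + 1, fun k hk i => ?_⟩
    have h1 : (k i).natAbs ≤ Finset.univ.sup fun i => (k i).natAbs :=
      Finset.le_sup (f := fun i => (k i).natAbs) (Finset.mem_univ i)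
    have h2 := Finset.le_sup (f := fun k : Fin d → ℤ => Finset.univ.sup fun i => (k i).natAbs) hk
    exact Nat.lt_succ_of_le (h1.trans h2)
  refine ⟨N, fun k hk => ?_⟩
  refine Finset.mem_biUnion.2 ⟨fun i => k i / 2 ^ N, ?_, mem_cubeIndices.2 fun i => rfl⟩
  rw [Fintype.mem_piFinset]
  intro i
  have h1 : ((k i).natAbs : ℤ) < 2 ^ N := by
    exact_mod_cast (hN k hk i).trans Nat.lt_two_pow_self
  have h2 : (0 : ℤ) < 2 ^ N := by positivity
  rw [Finset.mem_Ico, Int.le_ediv_iff_mul_le h2, Int.ediv_lt_iff_lt_mul h2]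
  omega

/-- The converse of `eNorm_le_lpMass`; the factor `2 ^ d` is the number of orthants. -/
theorem lpMass_le_eNorm {p : ℝ} (hp : 0 < p) (a : (Fin d → ℤ) → ℂ) :
    lpMass p a ≤ 2 ^ d * eNorm p p a ^ p := by
  rw [lpMass, ENNReal.tsum_eq_iSup_sum]
  refine iSup_le fun F => ?_
  obtain ⟨j, hj⟩ := exists_subset_biUnion_cubeIndices F
  refine (Finset.sum_le_sum_of_subset hj).trans ?_
  rw [Finset.sum_biUnion fun m _ m' _ hne => Finset.disjoint_left.2 fun k hk hk' => hne <|
    funext fun i => (mem_cubeIndices.1 hk i).symm.trans (mem_cubeIndices.1 hk' i)]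
  refine (Finset.sum_le_card_nsmul _ _ (eNorm p p a ^ p) fun m _ => ?_).trans (le_of_eq ?_)
  · simpa [div_self hp.ne'] using sum_le_eNorm (u := p) hp a j m
  · simp [Fintype.card_piFinset]

/-! ### Embeddings which are not strictly singular -/

theorem not_finiteDimensional_of_single_mem {ι : Type*} [DecidableEq ι]
    {M : Submodule ℂ (ι → ℂ)} {Z : Submodule ℂ M} {κ : ℕ → ι} (hκ : Function.Injective κ)
    (hM : ∀ i, Pi.single (κ i) 1 ∈ M) (hZ : ∀ i, ⟨Pi.single (κ i) 1, hM i⟩ ∈ Z) :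
    ¬ FiniteDimensional ℂ Z := by
  intro hfin
  let v : ℕ → Z := fun i => ⟨⟨Pi.single (κ i) 1, hM i⟩, hZ i⟩
  have hv : LinearIndependent ℂ v := by
    refine LinearIndependent.of_comp (M.subtype ∘ₗ Z.subtype) ?_
    exact (Pi.linearIndependent_single_one ι ℂ).comp _ hκ
  have := hv.finite
  exact not_finite ℕ

/-- On the sequences carried by the sparse set both quasi-norms are equivalent to the supremum. -/
theorem not_isStrictlySingular_of_lt (hd : 1 ≤ d) {u₁ p₁ u₂ p₂ : ℝ} (hp₁ : 0 < p₁)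
    (hp₂ : 0 < p₂) (hpu₁ : p₁ < u₁) (hle : morreySeqSpace d u₁ hp₁ ≤ morreySeqSpace d u₂ hp₂) :
    ¬ (morreySeqNorm d u₁ hp₁).IsStrictlySingular (morreySeqNorm d u₂ hp₂)
      (Submodule.inclusion hle) := by
  rintro ⟨-, hS⟩
  obtain ⟨C, hC, hbd⟩ := eNorm_le_of_support_sparse hd hp₁ hpu₁
  let W : Submodule ℂ ((Fin d → ℤ) → ℂ) :=
    { carrier := {a | ∀ k ∉ Set.range (sparsePoint d), a k = 0}
      zero_mem' := fun _ _ => rfl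
      add_mem' := fun ha hb k hk => by simp [ha k hk, hb k hk]
      smul_mem' := fun c a ha k hk => by simp [ha k hk] }
  let Z : Submodule ℂ (morreySeqSpace d u₁ hp₁) := W.comap (Submodule.subtype _)
  have hZ : ¬ FiniteDimensional ℂ Z := by
    have heW : ∀ i, Pi.single (sparsePoint d i) 1 ∈ W := fun i k hk =>
      Pi.single_eq_of_ne (fun h => hk ⟨i, h.symm⟩) _
    refine not_finiteDimensional_of_single_mem (sparsePoint_injective hd) (fun i => ?_) heW
    refine (hbd _ 1 (heW i) fun k => ?_).trans_lt (by simpa using hC.lt_top)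
    by_cases h : k = sparsePoint d i
    · simp [h]
    · simp [h]
  have hC0 : C.toReal + 1 > 0 := by positivity
  suffices h : (C.toReal + 1)⁻¹ ∈ lowerBounds _ from
    absurd ((hS Z hZ).2 h) (not_le.2 (inv_pos.2 hC0))
  rintro t ⟨⟨a, ha⟩, haZ, h1, rfl⟩
  change (eNorm u₁ p₁ a).toReal = 1 at h1
  change _ ≤ (eNorm u₂ p₂ a).toReal
  have hN : eNorm u₂ p₂ a ≠ ∞ := ne_of_lt (hle ha)
  have h2 := ENNReal.toReal_mono (ENNReal.mul_ne_top hC hN)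
    (hbd a (eNorm u₂ p₂ a) haZ (enorm_apply_le_eNorm u₂ hp₂ a))
  rw [h1, ENNReal.toReal_mul] at h2
  rw [inv_le_iff_one_le_mul₀' hC0]
  nlinarith [ENNReal.toReal_nonneg (a := eNorm u₂ p₂ a)]

theorem not_isStrictlySingular_inclusion_self (hd : 1 ≤ d) {p : ℝ} (hp : 0 < p)
    (hle : morreySeqSpace d p hp ≤ morreySeqSpace d p hp) :
    ¬ (morreySeqNorm d p hp).IsStrictlySingular (morreySeqNorm d p hp)
      (Submodule.inclusion hle) := by
  rintro ⟨-, hS⟩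
  have hZ : ¬ FiniteDimensional ℂ (⊤ : Submodule ℂ (morreySeqSpace d p hp)) := by
    refine not_finiteDimensional_of_single_mem (sparsePoint_injective hd) (fun i => ?_)
      fun _ => trivial
    refine (eNorm_le_lpMass hp _).trans_lt ?_
    rw [lpMass, tsum_eq_single (sparsePoint d i) fun k hk => by simp [hk, hp]]
    simp
  suffices h : (1 : ℝ) ∈ lowerBounds _ from absurd ((hS ⊤ hZ).2 h) (by norm_num)
  rintro t ⟨a, -, h1, rfl⟩
  exact h1.ge

/-! ### Strictly singular embeddings of `ℓ_p` -/

theorem morreySeqNorm_apply {u p : ℝ} (hp : 0 < p) (a : morreySeqSpace d u hp) :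
    (morreySeqNorm d u hp).toFun a = (eNorm u p (a : (Fin d → ℤ) → ℂ)).toReal := rfl

theorem isBoundedOp_inclusion {u₁ p₁ u₂ p₂ : ℝ} (hp₁ : 0 < p₁) (hp₂ : 0 < p₂)
    (hle : morreySeqSpace d u₁ hp₁ ≤ morreySeqSpace d u₂ hp₂)
    (hbd : ∀ a : (Fin d → ℤ) → ℂ, eNorm u₂ p₂ a ≤ eNorm u₁ p₁ a) :
    (morreySeqNorm d u₁ hp₁).IsBoundedOp (morreySeqNorm d u₂ hp₂) (Submodule.inclusion hle) := by
  refine ⟨1, ?_⟩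
  rintro ⟨a, ha⟩
  have h : (eNorm u₂ p₂ a).toReal ≤ (eNorm u₁ p₁ a).toReal :=
    ENNReal.toReal_mono (ne_of_lt ha) (hbd a)
  rw [one_mul]
  exact h

/-- The embedding `ℓ_p → m_{u,q}` is strictly singular as soon as the sum of `n` suitably sparse
finitely supported sequences of mass at most `1` has norm at most `g n` in `m_{u,q}`, where `g n`
grows more slowly than `n^{1/p}`: the gliding hump has norm of order at least `n^{1/p}` in `ℓ_p`.
-/
theorem isStrictlySingular_of_growth {p u q : ℝ} (hp : 0 < p) (hq : 0 < q)
    (hle : morreySeqSpace d p hp ≤ morreySeqSpace d u hq)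
    (hbd : ∀ a : (Fin d → ℤ) → ℂ, eNorm u q a ≤ eNorm p p a) {g : ℕ → ℝ≥0∞}
    (hg : ∀ C : ℝ≥0∞, C ≠ ∞ → ∃ n, C * (g n + 1) ^ p < n)
    (hA : ∀ n, ∀ y : (Fin d → ℤ) → ℂ, y.support.Finite → eNorm u q y ≤ g n →
      ∃ F : Finset (Fin d → ℤ), ∀ y' : (Fin d → ℤ) → ℂ,
        (∀ k ∈ F, y' k = 0) → lpMass p y' ≤ 1 → eNorm u q (y + y') ≤ g (n + 1)) :
    (morreySeqNorm d p hp).IsStrictlySingular (morreySeqNorm d u hq)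
      (Submodule.inclusion hle) := by
  refine ⟨isBoundedOp_inclusion hp hq hle hbd, fun Z hZ => ⟨?_, ?_⟩⟩
  · rintro t ⟨a, -, -, rfl⟩
    exact ENNReal.toReal_nonneg
  intro b hb
  by_contra! hb0
  have hlow : ∀ a ∈ Z, eNorm p p (a : (Fin d → ℤ) → ℂ) ≤
      ENNReal.ofReal b⁻¹ * eNorm u q (a : (Fin d → ℤ) → ℂ) := by
    rintro ⟨a, ha⟩ haZ
    have h := QuasiNorm.mul_le_of_mem_lowerBounds hb haZ
    rw [morreySeqNorm_apply, morreySeqNorm_apply, Submodule.coe_inclusion] at h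
    rw [← ENNReal.ofReal_toReal (ne_of_lt ha), ← ENNReal.ofReal_toReal (ne_of_lt (hle ha)),
      ← ENNReal.ofReal_mul (by positivity)]
    refine ENNReal.ofReal_le_ofReal ?_
    rwa [inv_mul_eq_div, le_div_iff₀' hb0]
  set c := ENNReal.ofReal b⁻¹
  let W := Z.map (morreySeqSpace d p hp).subtype
  have hW : ¬ FiniteDimensional ℂ W := fun h =>
    hZ (Module.Finite.equiv (Submodule.equivMapOfInjective _
      (Submodule.subtype_injective _) Z).symm)
  have hfin : ∀ x ∈ W, lpMass p x ≠ ∞ := by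
    rintro x ⟨a, -, rfl⟩
    refine ne_top_of_le_ne_top ?_ (lpMass_le_eNorm hp _)
    exact ENNReal.mul_ne_top (by simp) (ENNReal.rpow_ne_top_of_nonneg hp.le (ne_of_lt a.2))
  set K : ℝ≥0∞ := 2 * 2 ^ (1 / q)
  have hK : K ≠ ∞ := ENNReal.mul_ne_top (by norm_num)
    (ENNReal.rpow_ne_top_of_nonneg (by positivity) (by norm_num))
  have h2p : (2 : ℝ≥0∞) ^ p ≠ ∞ := ENNReal.rpow_ne_top_of_nonneg hp.le (by norm_num)
  obtain ⟨n, hn⟩ := hg (2 * (2 ^ p * (2 ^ d * (c * K) ^ p + 1))) <| by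
    refine ENNReal.mul_ne_top (by norm_num) (ENNReal.mul_ne_top h2p (ENNReal.add_ne_top.2
      ⟨ENNReal.mul_ne_top (by simp) (ENNReal.rpow_ne_top_of_nonneg hp.le
        (ENNReal.mul_ne_top ENNReal.ofReal_ne_top hK)), by norm_num⟩))
  refine hn.not_ge ?_
  obtain ⟨x, ⟨a, ha, rfl⟩, y, -, hny, hyg, hxy⟩ := exists_gliding_hump hp hW hfin
    (A := eNorm u q) (g := g) (by simp [eNorm_zero u hq]) hA n one_ne_zero
  set x : (Fin d → ℤ) → ℂ := (morreySeqSpace d p hp).subtype a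
  have hxy' : eNorm u q (x - y) ≤ 1 := (hbd _).trans ((eNorm_le_lpMass hp _).trans
    (ENNReal.rpow_le_one hxy (by positivity)))
  have hx : eNorm u q x ≤ K * (g n + 1) := by
    have := eNorm_add_le u hq y (x - y)
    rw [add_sub_cancel] at this
    exact this.trans (by gcongr)
  have hLx : lpMass p x ≤ 2 ^ d * (c * K) ^ p * (g n + 1) ^ p := by
    refine (lpMass_le_eNorm hp x).trans ?_
    rw [mul_assoc, ← ENNReal.mul_rpow_of_nonneg _ _ hp.le, mul_assoc c]
    gcongr
    exact (hlow a ha).trans (by gcongr; exact hx)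
  have h1 : (1 : ℝ≥0∞) ≤ (g n + 1) ^ p := ENNReal.one_le_rpow le_add_self hp
  have hLy : lpMass p y ≤ 2 ^ p * (2 ^ d * (c * K) ^ p + 1) * (g n + 1) ^ p := by
    have := lpMass_sub_le hp x (x - y)
    rw [sub_sub_cancel] at this
    refine this.trans ?_
    rw [mul_assoc, add_mul, one_mul]
    gcongr
    exact hxy.trans h1
  have := (ENNReal.div_le_iff (by norm_num) (by norm_num)).1 (hny.trans hLy)
  refine this.trans (le_of_eq ?_)
  ring

/-- For `p < q`, the sum of `n` disjoint humps has norm at most `n^{1/q}` in `ℓ_q`. -/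
theorem isStrictlySingular_lp_lp {p q : ℝ} (hp : 0 < p) (hpq : p < q) (hq : 0 < q)
    (hle : morreySeqSpace d p hp ≤ morreySeqSpace d q hq)
    (hbd : ∀ a : (Fin d → ℤ) → ℂ, eNorm q q a ≤ eNorm p p a) :
    (morreySeqNorm d p hp).IsStrictlySingular (morreySeqNorm d q hq)
      (Submodule.inclusion hle) := by
  have hpow : ∀ n : ℕ, ((n : ℝ≥0∞) ^ (1 / q)) ^ q = n := fun n => by
    rw [← ENNReal.rpow_mul, one_div_mul_cancel hq.ne', ENNReal.rpow_one]
  refine isStrictlySingular_of_growth hp hq hle hbd (g := fun n => (n : ℝ≥0∞) ^ (1 / q)) ?_ ?_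
  · intro C hC
    have hs : 0 < 1 - p / q := by rw [sub_pos, div_lt_one hq]; exact hpq
    have hC2 : C * 2 ^ p ≠ ∞ :=
      ENNReal.mul_ne_top hC (ENNReal.rpow_ne_top_of_nonneg hp.le (by norm_num))
    obtain ⟨n, hn⟩ := ENNReal.exists_nat_gt (r := (C * 2 ^ p) ^ (1 / (1 - p / q)))
      (ENNReal.rpow_ne_top_of_nonneg (by positivity) hC2)
    have hn0 : (n : ℝ≥0∞) ≠ 0 := (bot_le.trans_lt hn).ne'
    have hn1 : (1 : ℝ≥0∞) ≤ n := by
      have : n ≠ 0 := by simpa using hn0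
      exact_mod_cast Nat.one_le_iff_ne_zero.2 this
    have hlt : C * 2 ^ p < (n : ℝ≥0∞) ^ (1 - p / q) := by
      rw [one_div, ENNReal.rpow_inv_lt_iff hs] at hn
      exact hn
    refine ⟨n, ?_⟩
    calc C * ((n : ℝ≥0∞) ^ (1 / q) + 1) ^ p ≤ C * (2 * (n : ℝ≥0∞) ^ (1 / q)) ^ p := by
          rw [two_mul]
          gcongr
          exact ENNReal.one_le_rpow hn1 (by positivity)
      _ = (C * 2 ^ p) * (n : ℝ≥0∞) ^ (p / q) := by
          rw [ENNReal.mul_rpow_of_nonneg _ _ hp.le, ← ENNReal.rpow_mul, mul_assoc]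
          congr 3
          ring
      _ < (n : ℝ≥0∞) ^ (1 - p / q) * (n : ℝ≥0∞) ^ (p / q) := by
          refine ENNReal.mul_lt_mul_left ?_ ?_ hlt
          · exact (ENNReal.rpow_pos (pos_iff_ne_zero.2 hn0) (by simp)).ne'
          · exact ENNReal.rpow_ne_top_of_nonneg (by positivity) (by simp)
      _ = n := by
          rw [← ENNReal.rpow_add _ _ hn0 (by simp), sub_add_cancel, ENNReal.rpow_one]
  · intro n y hy hyn
    refine ⟨hy.toFinset, fun y' hy' hL => ?_⟩
    rw [eNorm_le_iff hq] at hyn ⊢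
    have hy1 := (eNorm_le_iff hq y' 1).1 ((hbd y').trans ((eNorm_le_lpMass hp _).trans
      (ENNReal.rpow_le_one hL (by positivity))))
    intro j m
    specialize hyn j m
    specialize hy1 j m
    simp only [hpow, ENNReal.one_rpow, div_self hq.ne', sub_self, ENNReal.rpow_zero, mul_one]
      at hyn hy1 ⊢
    push_cast
    refine le_trans (le_of_eq ?_) (add_le_add hyn hy1)
    rw [← Finset.sum_add_distrib]
    refine Finset.sum_congr rfl fun k _ => enorm_add_rpow_of_disjoint hq ?_
    by_cases h : y k = 0
    · exact Or.inl h
    · exact Or.inr (hy' k (by simp [h]))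

/-- For `q < u`, a sum of sparse humps stays bounded in `m_{u,q}`: a cube which meets the new hump
and an old one is so large that the old ones contribute at most `1` to it. -/
theorem isStrictlySingular_lp_morrey (hd : 1 ≤ d) {p u q : ℝ} (hp : 0 < p) (hq : 0 < q)
    (hqu : q < u) (hle : morreySeqSpace d p hp ≤ morreySeqSpace d u hq)
    (hbd : ∀ a : (Fin d → ℤ) → ℂ, eNorm u q a ≤ eNorm p p a) :
    (morreySeqNorm d p hp).IsStrictlySingular (morreySeqNorm d u hq)
      (Submodule.inclusion hle) := by
  classical
  have hpow : ((2 : ℝ≥0∞) ^ (1 / q)) ^ q = 2 := by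
    rw [← ENNReal.rpow_mul, one_div_mul_cancel hq.ne', ENNReal.rpow_one]
  have hg : (2 : ℝ≥0∞) ^ (1 / q) ≠ ∞ :=
    ENNReal.rpow_ne_top_of_nonneg (by positivity) (by norm_num)
  have hδ : 0 < 1 - q / u := by rw [sub_pos, div_lt_one (hq.trans hqu)]; exact hqu
  refine isStrictlySingular_of_growth hp hq hle hbd (g := fun _ => 2 ^ (1 / q)) ?_ ?_
  · intro C hC
    exact ENNReal.exists_nat_gt (ENNReal.mul_ne_top hC
      (ENNReal.rpow_ne_top_of_nonneg hp.le (ENNReal.add_ne_top.2 ⟨hg, by norm_num⟩)))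
  · intro _ y hy hyn
    -- cubes of level at least `j₀` are so large that the contribution of `y` to them is at most 1
    obtain ⟨j₀, hj₀⟩ : ∃ j₀ : ℕ, ∀ j ≥ j₀, ∑ k ∈ hy.toFinset, ‖y k‖ₑ ^ q ≤
        ((2 : ℝ≥0∞) ^ (j * d)) ^ (1 - q / u) := by
      set S := ∑ k ∈ hy.toFinset, ‖y k‖ₑ ^ q
      have hS : S ≠ ∞ := ENNReal.sum_ne_top.2 fun k _ =>
        ENNReal.rpow_ne_top_of_nonneg hq.le enorm_ne_top
      obtain ⟨n, hn⟩ := ENNReal.exists_nat_gt (r := S ^ (1 / (1 - q / u)))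
        (ENNReal.rpow_ne_top_of_nonneg (by positivity) hS)
      refine ⟨n, fun j hj => ?_⟩
      rw [one_div, ENNReal.rpow_inv_lt_iff hδ] at hn
      refine hn.le.trans ?_
      gcongr
      have : n ≤ 2 ^ (j * d) := (hj.trans (Nat.le_mul_of_pos_right j hd)).trans
        Nat.lt_two_pow_self.le
      exact_mod_cast this
    -- `y'` has to vanish on all smaller cubes which meet the support of `y`
    refine ⟨hy.toFinset ∪ (Finset.range j₀).biUnion fun j =>
      hy.toFinset.biUnion fun k => cubeIndices j fun i => k i / 2 ^ j, fun y' hy' hL => ?_⟩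
    rw [eNorm_le_iff hq] at hyn ⊢
    have hy1 := (eNorm_le_iff hq y' 1).1 ((hbd y').trans ((eNorm_le_lpMass hp _).trans
      (ENNReal.rpow_le_one hL (by positivity))))
    intro j m
    specialize hyn j m
    specialize hy1 j m
    rw [hpow] at hyn ⊢
    rw [ENNReal.one_rpow, one_mul] at hy1
    have hdisj : ∀ k, y k = 0 ∨ y' k = 0 := fun k => by
      by_cases h : y k = 0
      · exact Or.inl h
      · exact Or.inr (hy' k (Finset.mem_union_left _ (by simp [h])))
    have hsum : ∑ k ∈ cubeIndices j m, ‖(y + y') k‖ₑ ^ q =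
        ∑ k ∈ cubeIndices j m, ‖y k‖ₑ ^ q + ∑ k ∈ cubeIndices j m, ‖y' k‖ₑ ^ q := by
      rw [← Finset.sum_add_distrib]
      exact Finset.sum_congr rfl fun k _ => enorm_add_rpow_of_disjoint hq (hdisj k)
    rw [hsum]
    rcases le_or_gt j₀ j with hj | hj
    · rw [two_mul]
      refine add_le_add (le_trans ?_ (hj₀ j hj)) hy1
      refine Finset.sum_le_sum_of_ne_zero fun k _ hk => ?_
      rw [Set.Finite.mem_toFinset, Function.mem_support]
      rintro h
      simp [h, hq] at hk
    · by_cases hmeet : ∃ k ∈ cubeIndices j m, y k ≠ 0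
      · obtain ⟨k, hkm, hk⟩ := hmeet
        have hm : m = fun i => k i / 2 ^ j := funext fun i => (mem_cubeIndices.1 hkm i).symm
        rw [Finset.sum_eq_zero (f := fun k => ‖y' k‖ₑ ^ q), add_zero]
        · exact hyn
        · intro l hl
          rw [hy' l, enorm_zero, ENNReal.zero_rpow_of_pos hq]
          refine Finset.mem_union_right _ (Finset.mem_biUnion.2 ⟨j, Finset.mem_range.2 hj, ?_⟩)
          exact Finset.mem_biUnion.2 ⟨k, by simpa using hk, hm ▸ hl⟩
      · push Not at hmeet
        rw [Finset.sum_eq_zero (f := fun k => ‖y k‖ₑ ^ q), zero_add]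
        · exact hy1.trans (le_mul_of_one_le_left' (by norm_num))
        · intro l hl
          rw [hmeet l hl, enorm_zero, ENNReal.zero_rpow_of_pos hq]

end MorreySeq

theorem mainTheorem10 (d : ℕ) (hd : 1 ≤ d) (u₁ p₁ u₂ p₂ : ℝ)
    (hp₁ : 0 < p₁) (hpu₁ : p₁ ≤ u₁) (hp₂ : 0 < p₂) (hpu₂ : p₂ ≤ u₂)
    (hu : u₁ / u₂ ≤ min 1 (p₁ / p₂)) :
    ∃ hle : morreySeqSpace d u₁ hp₁ ≤ morreySeqSpace d u₂ hp₂,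
      (morreySeqNorm d u₁ hp₁).IsBoundedOp (morreySeqNorm d u₂ hp₂) (Submodule.inclusion hle) ∧
      (p₂ < u₂ →
        ((morreySeqNorm d u₁ hp₁).IsStrictlySingular (morreySeqNorm d u₂ hp₂)
          (Submodule.inclusion hle) ↔ p₁ = u₁)) ∧
      (p₂ = u₂ →
        ((morreySeqNorm d u₁ hp₁).IsStrictlySingular (morreySeqNorm d u₂ hp₂)
          (Submodule.inclusion hle) ↔ u₁ = p₁ ∧ p₁ < p₂)) ∧
      (p₁ < u₁ →
        ¬ (morreySeqNorm d u₁ hp₁).IsStrictlySingular (morreySeqNorm d u₂ hp₂)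
          (Submodule.inclusion hle)) := by
  have hbd : ∀ a : (Fin d → ℤ) → ℂ, MorreySeq.eNorm u₂ p₂ a ≤ MorreySeq.eNorm u₁ p₁ a :=
    MorreySeq.eNorm_le_eNorm hp₁ hpu₁ hp₂ hpu₂ hu
  have hle : morreySeqSpace d u₁ hp₁ ≤ morreySeqSpace d u₂ hp₂ := fun a ha =>
    (hbd a).trans_lt ha
  have hnot : p₁ < u₁ → ¬ (morreySeqNorm d u₁ hp₁).IsStrictlySingular (morreySeqNorm d u₂ hp₂)
      (Submodule.inclusion hle) := fun h =>
    MorreySeq.not_isStrictlySingular_of_lt hd hp₁ hp₂ h hle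
  have heq : (morreySeqNorm d u₁ hp₁).IsStrictlySingular (morreySeqNorm d u₂ hp₂)
      (Submodule.inclusion hle) → p₁ = u₁ := fun h =>
    hpu₁.eq_or_lt.resolve_right fun hlt => hnot hlt h
  refine ⟨hle, MorreySeq.isBoundedOp_inclusion hp₁ hp₂ hle hbd,
    fun h2 => ⟨heq, ?_⟩, fun h2 => ⟨fun h => ?_, ?_⟩, hnot⟩
  · rintro rfl
    exact MorreySeq.isStrictlySingular_lp_morrey hd hp₁ hp₂ h2 hle hbd
  -- now `p₁ = u₁ ≤ u₂ = p₂`, and for equality the embedding is the identity of `ℓ_{p₁}`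
  · obtain rfl := heq h
    subst h2
    refine ⟨rfl, lt_of_le_of_ne ?_ ?_⟩
    · have := hu.trans (min_le_left _ _)
      rwa [div_le_one hp₂] at this
    · rintro rfl
      exact MorreySeq.not_isStrictlySingular_inclusion_self hd hp₁ hle h
  · rintro ⟨rfl, hlt⟩
    subst h2
    exact MorreySeq.isStrictlySingular_lp_lp hp₁ hlt hp₂ hle hbd
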